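/- Let $p$ be an odd prime, let $m \ge 3$ and $l \ge 1$ be integers with $\gcd(m,l)=1$, put $q=p^m$, and let $\mathrm{Tr}$ be the trace from $\mathbb{F}_q$ to $\mathbb{F}_p$. Consider the linear code over $\mathbb{F}_p$, with coordinates indexed by $\mathbb{F}_q$, $$C=\bigl\{\bigl(\mathrm{Tr}(ax^{p^l+1}+bx)+h\bigr)_{x\in\mathbb{F}_q} : a,b\in\mathbb{F}_q,\ h\in\mathbb{F}_p\bigr\}.$$ Then $C$ has length $p^m$ and dimension $2m+1$ over $\mathbb{F}_p$. For each integer $w$ let $A_w$ be the number of codewords of $C$ of Hamming weight $w$. (i) If $m$ is odd, then $C$ has exactly four nonzero weights, and $A_w=0$ for all $w$ except the following pairwise distinct values, for which - $A_0=1$; - $A_w=p(p^{m-1}+1)(p^m-1)$ for $w=p^{m-1}(p-1)$; - $A_w=\tfrac12p^m(p-1)(p^m-1)$ for $w=p^{m-1}(p-1)+p^{\frac{m-1}{2}}$; - $A_w=\tfrac12p^m(p-1)(p^m-1)$ for $w=p^{m-1}(p-1)-p^{\frac{m-1}{2}}$; - $A_w=p-1$ for $w=p^m$. (ii) If $m$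 is even, then, with $\varepsilon=(-1)^{m/2}$, $C$ has exactly six nonzero weights, and $A_w=0$ for all $w$ except the following pairwise distinct values, for which - $A_0=1$; - $A_w=p(p^{m-1}-p^{m-2}+1)(p^m-1)$ for $w=p^{m-1}(p-1)$; - $A_w=p^{m+1}(p^m-1)/(p+1)$ for $w=p^{m-1}(p-1)-\varepsilon p^{\frac m2-1}(p-1)$; - $A_w=p^{m+1}(p-1)(p^m-1)/(p+1)$ for $w=p^{m-1}(p-1)+\varepsilon p^{\frac m2-1}$; - $A_w=p^{m-2}(p^m-1)/(p+1)$ for $w=p^{m-1}(p-1)+\varepsilon p^{\frac m2}(p-1)$; - $A_w=p^{m-2}(p-1)(p^m-1)/(p+1)$ for $w=p^{m-1}(p-1)-\varepsilon p^{\frac m2}$; - $A_w=p-1$ for $w=p^m$. -/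

import Mathlib

section Codes

variable {K ι : Type*} [Field K] [Fintype ι] [DecidableEq K]

/-- The length of a linear code whose coordinates are indexed by `ι`. -/
def codeLength (_C : Submodule K (ι → K)) : ℕ := Fintype.card ι

/-- `A_w`: the number of codewords of Hamming weight `w`. The argument is an integer so that
weights given by expressions with signs need no truncated subtraction. -/
noncomputable def weightCount (C : Submodule K (ι → K)) (w : ℤ) : ℕ :=
  Set.ncard {c : ι → K | c ∈ C ∧ (hammingNorm c : ℤ) = w}

/-- The code `C` is a `k`-weight code: exactly `k` of the numbers `A_1, ..., A_n` are nonzero,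
where `n` is the length of `C`. -/
def IsKWeightCode (C : Submodule K (ι → K)) (k : ℕ) : Prop :=
  {i : ℕ | 1 ≤ i ∧ i ≤ codeLength C ∧ weightCount C (i : ℤ) ≠ 0}.ncard = k

/-- The weight distribution of `C` is given by the table `T` of rows `(weight, multiplicity)`:
the listed weights are pairwise distinct, each occurs with the listed multiplicity, and no other
weight occurs. -/
def HasWeightDistribution (C : Submodule K (ι → K)) (T : List (ℤ × ℚ)) : Prop :=
  (T.map Prod.fst).Nodup ∧
  (∀ r ∈ T, (weightCount C r.1 : ℚ) = r.2) ∧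
  ∀ w : ℤ, w ∉ T.map Prod.fst → weightCount C w = 0

end Codes

/-- The code `{(Tr(a x^(p^l+1) + b x) + h)_{x ∈ F} : a, b ∈ F, h ∈ F_p}` over `F_p = ZMod p`,
with coordinates indexed by the elements of `F`. -/
noncomputable def traceCode (p l : ℕ) [Fact p.Prime] (F : Type*) [Field F] [Algebra (ZMod p) F] :
    Submodule (ZMod p) (F → ZMod p) where
  carrier := {c | ∃ (a b : F) (h : ZMod p),
    c = fun x => Algebra.trace (ZMod p) F (a * x ^ (p ^ l + 1) + b * x) + h}
  zero_mem' := ⟨0, 0, 0, by ext x; simp⟩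
  add_mem' := by
    rintro _ _ ⟨a, b, h, rfl⟩ ⟨a', b', h', rfl⟩
    refine ⟨a + a', b + b', h + h', ?_⟩
    ext x
    simp only [Pi.add_apply, add_mul, map_add]
    ring
  smul_mem' := by
    rintro t _ ⟨a, b, h, rfl⟩
    refine ⟨t • a, t • b, t * h, ?_⟩
    ext x
    simp only [Pi.smul_apply, smul_mul_assoc, map_add, map_smul, smul_eq_mul]
    ring

/-- Weights and multiplicities for odd `m`. -/
def oddWeightTable (p m : ℕ) : List (ℤ × ℚ) :=
  [(0, 1),
   ((p : ℤ) ^ (m - 1) * ((p : ℤ) - 1),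
      (p : ℚ) * ((p : ℚ) ^ (m - 1) + 1) * ((p : ℚ) ^ m - 1)),
   ((p : ℤ) ^ (m - 1) * ((p : ℤ) - 1) + (p : ℤ) ^ ((m - 1) / 2),
      1 / 2 * (p : ℚ) ^ m * ((p : ℚ) - 1) * ((p : ℚ) ^ m - 1)),
   ((p : ℤ) ^ (m - 1) * ((p : ℤ) - 1) - (p : ℤ) ^ ((m - 1) / 2),
      1 / 2 * (p : ℚ) ^ m * ((p : ℚ) - 1) * ((p : ℚ) ^ m - 1)),
   ((p : ℤ) ^ m, (p : ℚ) - 1)]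

/-- Weights and multiplicities for even `m`. -/
def evenWeightTable (p m : ℕ) : List (ℤ × ℚ) :=
  [(0, 1),
   ((p : ℤ) ^ (m - 1) * ((p : ℤ) - 1),
      (p : ℚ) * ((p : ℚ) ^ (m - 1) - (p : ℚ) ^ (m - 2) + 1) * ((p : ℚ) ^ m - 1)),
   ((p : ℤ) ^ (m - 1) * ((p : ℤ) - 1) - (-1) ^ (m / 2) * (p : ℤ) ^ (m / 2 - 1) * ((p : ℤ) - 1),
      (p : ℚ) ^ (m + 1) * ((p : ℚ) ^ m - 1) / ((p : ℚ) + 1)),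
   ((p : ℤ) ^ (m - 1) * ((p : ℤ) - 1) + (-1) ^ (m / 2) * (p : ℤ) ^ (m / 2 - 1),
      (p : ℚ) ^ (m + 1) * ((p : ℚ) - 1) * ((p : ℚ) ^ m - 1) / ((p : ℚ) + 1)),
   ((p : ℤ) ^ (m - 1) * ((p : ℤ) - 1) + (-1) ^ (m / 2) * (p : ℤ) ^ (m / 2) * ((p : ℤ) - 1),
      (p : ℚ) ^ (m - 2) * ((p : ℚ) ^ m - 1) / ((p : ℚ) + 1)),
   ((p : ℤ) ^ (m - 1) * ((p : ℤ) - 1) - (-1) ^ (m / 2) * (p : ℤ) ^ (m / 2),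
      (p : ℚ) ^ (m - 2) * ((p : ℚ) - 1) * ((p : ℚ) ^ m - 1) / ((p : ℚ) + 1)),
   ((p : ℤ) ^ m, (p : ℚ) - 1)]

/-! For fixed `a`, the map `x ↦ Tr(a x^(p^l+1))` is a quadratic form `Q_a` over `ZMod p`, and a
codeword's weight is `p^m` minus the number of zeros of `Q_a + Tr(b x) + h`. If the linear part lies
in the image of the polar form, completing the square turns this number into a fiber size of `Q_a`.
Otherwise the linear part is nonzero somewhere on the radical, and the number is `p^(m-1)`.
Diagonalization gives the fiber sizes in terms of rank and one sign (`QuadraticForm.card_fiber`,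
`QuadraticForm.card_affine_zeros`).

For `a ≠ 0`, a nonzero `c` lies in the radical exactly when `y = a c^(p^l+1)` satisfies `y^(p^l-1) =
-1`. For odd `m` this is impossible, so the form is nondegenerate; its sign is irrelevant because
`h` takes square and nonsquare values equally often. For even `m` the radical has 1 or `p^2`
elements. The sign is forced by a free action of the `(p+1)`-th roots of unity on the fibers over
nonzero values (`add_one_dvd_card_frobeniusForm_fiber`), and the total radical size over all `a`
(`sum_card_polarRadical_frobeniusForm`) fixes how often each rank occurs.

Exactly one triple `(a,b,h)` has weight zero, so the encoder is injective. This gives the dimension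
and turns counts of triples into counts of codewords. -/

/-! ### Radicals of quadratic forms and diagonal forms. -/

section PolarRadical

open Finset

variable {K V : Type*} [Field K] [AddCommGroup V] [Module K V]

/-- The vectors orthogonal to the whole space under the polar form of `Q`. -/
def polarRadical (Q : QuadraticForm K V) :
    Submodule K V :=
  LinearMap.ker Q.polarBilin

theorem mem_polarRadical {Q : QuadraticForm K V}
    {x : V} : x ∈ polarRadical Q ↔ ∀ y, QuadraticMap.polar Q x y = 0 := by
  simp [polarRadical, LinearMap.ext_iff]

theorem polar_weightedSumSquares {n : ℕ} (w x y : Fin n → K) :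
    QuadraticMap.polar (QuadraticMap.weightedSumSquares K w) x y =
      ∑ i, 2 * (w i * x i) * y i := by
  simp only [QuadraticMap.polar, QuadraticMap.weightedSumSquares_apply, Pi.add_apply,
    ← sum_sub_distrib, smul_eq_mul]
  exact sum_congr rfl fun i _ => by ring

theorem card_weighted_sq_cons [Fintype K] {n : ℕ} (w : Fin (n + 1) → K) (h : K) :
    Nat.card {x : Fin (n + 1) → K // ∑ i, w i * x i ^ 2 = h} =
      ∑ t : K, Nat.card {x : Fin n → K // ∑ i, w i.succ * x i ^ 2 = h - w 0 * t ^ 2} := by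
  rw [← Nat.card_sigma]
  refine Nat.card_congr ⟨fun x => ⟨x.1 0, fun i => x.1 i.succ, ?_⟩,
    fun y => ⟨Fin.cons y.1 y.2.1, ?_⟩, fun x => ?_, fun y => ?_⟩
  · have := x.2
    rw [Fin.sum_univ_succ] at this
    linear_combination this
  · rw [Fin.sum_univ_succ]
    simp only [Fin.cons_zero, Fin.cons_succ, y.2.2]; ring
  · ext i; refine Fin.cases ?_ (fun i => ?_) i <;> simp
  · rfl

end PolarRadical

/-! ### Fiber sizes of quadratic forms over a finite field. -/

section QuadraticCounting

open Finset

variable {K : Type*} [Field K] [Fintype K] [DecidableEq K]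

/-- For `h ≠ 0`, scaling `u` by `h` reduces the sum to the Jacobi sum of the quadratic character
with its inverse; for `h = 0` every nonzero term equals `χ(-1)`. -/
theorem quadraticChar_sum_mul_sub (hK : ringChar K ≠ 2) (h : K) :
    ∑ u : K, quadraticChar K u * quadraticChar K (h - u) =
      quadraticChar K (-1) * ((if h = 0 then (Fintype.card K : ℤ) else 0) - 1) := by
  by_cases hh : h = 0
  · subst hh
    have h1 : ∀ u : K, quadraticChar K u * quadraticChar K (0 - u) =
        quadraticChar K (-1) * (if u = 0 then 0 else 1) := by
      intro u
      split_ifs with hu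
      · simp [hu]
      · have := quadraticChar_sq_one hu
        rw [zero_sub, neg_eq_neg_one_mul, map_mul]
        linear_combination quadraticChar K (-1) * this
    simp_rw [h1, ← mul_sum]
    congr 1
    have h2 : ∀ u : K, (if u = 0 then (0 : ℤ) else 1) = 1 - if u = 0 then 1 else 0 := by
      intro u; split_ifs <;> simp
    simp_rw [h2, sum_sub_distrib]
    simp
  · rw [← Equiv.sum_comp (Equiv.mulLeft₀ h hh)]
    have h1 : ∀ u : K, quadraticChar K (Equiv.mulLeft₀ h hh u) *
        quadraticChar K (h - Equiv.mulLeft₀ h hh u) =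
        quadraticChar K u * quadraticChar K (1 - u) := by
      intro u
      have := quadraticChar_sq_one hh
      have h3 : h - h * u = h * (1 - u) := by ring
      simp only [Equiv.mulLeft₀_apply, h3, map_mul]
      linear_combination quadraticChar K u * quadraticChar K (1 - u) * this
    simp_rw [h1]
    have h4 := jacobiSum_nontrivial_inv (quadraticChar_ne_one hK)
    rw [(quadraticChar_isQuadratic K).inv, jacobiSum] at h4
    rw [h4]; simp [hh]

theorem sum_comp_mul_sq (hK : ringChar K ≠ 2) {w : K} (hw : w ≠ 0) (g : K → ℤ) :
    ∑ t : K, g (w * t ^ 2) = ∑ u : K, (1 + quadraticChar K (u * w)) * g u := by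
  rw [← Equiv.sum_comp (Equiv.mulLeft₀ w hw) (fun u => (1 + quadraticChar K (u * w)) * g u),
    ← sum_fiberwise univ (fun t : K => t ^ 2)]
  refine sum_congr rfl fun a _ => ?_
  have h1 := quadraticChar_card_sqrts hK a
  have h2 : quadraticChar K (w * a * w) = quadraticChar K a := by
    have := quadraticChar_sq_one hw
    simp only [map_mul]
    linear_combination quadraticChar K a * this
  simp only [Equiv.mulLeft₀_apply, h2]
  rw [add_comm, ← h1]
  rw [sum_congr rfl (g := fun _ => g (w * a)) (by
    intro t ht; simp only [mem_filter] at ht; rw [ht.2])]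
  simp

/-- The deviation from `q ^ n` of `q` times the number of zeros of `Q - h`, for a quadratic form
`Q` with `k` nonzero and `r` zero diagonal coefficients. -/
noncomputable def quadDeviation (k r : ℕ) (η : ℤ) (h : K) : ℤ :=
  if Even k then
    η * (Fintype.card K : ℤ) ^ (k / 2 + r) * ((if h = 0 then (Fintype.card K : ℤ) else 0) - 1)
  else η * (Fintype.card K : ℤ) ^ ((k + 1) / 2 + r) * quadraticChar K h

theorem quadDeviation_succ_right (k r : ℕ) (η : ℤ) (h : K) :
    quadDeviation k (r + 1) η h = Fintype.card K * quadDeviation k r η h := by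
  unfold quadDeviation
  split_ifs <;> ring

/-- The inductive step for one more nonzero diagonal coefficient: summing over `t` switches between
the two parity shapes and multiplies the sign by `χ(w)`, with an extra `χ(-1)` when `k` is odd. -/
theorem sum_quadDeviation_sub_mul_sq (hK : ringChar K ≠ 2) {w : K} (hw : w ≠ 0) (k r : ℕ)
    {η : ℤ} (hη : η = 1 ∨ η = -1) :
    ∃ η' : ℤ, (η' = 1 ∨ η' = -1) ∧ ∀ h : K,
      ∑ t : K, quadDeviation k r η (h - w * t ^ 2) = quadDeviation (k + 1) r η' h := by
  have hχw := quadraticChar_dichotomy hw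
  have hχ1 := quadraticChar_dichotomy (F := K) (neg_ne_zero.2 one_ne_zero)
  have hχ0 := quadraticChar_sum_zero hK
  rcases Nat.even_or_odd k with hk | hk
  · refine ⟨η * quadraticChar K w, ?_, fun h => ?_⟩
    · rcases hη with rfl | rfl <;> rcases hχw with e | e <;> simp [e]
    · rw [sum_comp_mul_sq hK hw (fun u => quadDeviation k r η (h - u))]
      have hk' : ¬ Even (k + 1) := by simpa [Nat.even_add_one] using hk
      have e : (k + 1 + 1) / 2 = k / 2 + 1 := by omega
      simp only [quadDeviation, if_pos hk, if_neg hk', sub_eq_zero, e]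
      have h1 : ∀ u : K, (1 + quadraticChar K (u * w)) * (η * (Fintype.card K : ℤ) ^ (k / 2 + r) *
          ((if h = u then (Fintype.card K : ℤ) else 0) - 1)) =
          η * (Fintype.card K : ℤ) ^ (k / 2 + r) * ((if h = u then (Fintype.card K : ℤ) *
            (1 + quadraticChar K (u * w)) else 0) - 1 - quadraticChar K u * quadraticChar K w) := by
        intro u
        rw [map_mul]
        split_ifs <;> ring
      simp_rw [h1, ← mul_sum, sum_sub_distrib, ← sum_mul, hχ0, map_mul]
      simp only [sum_ite_eq, mem_univ, if_true, sum_const, card_univ, nsmul_eq_mul]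
      ring
  · refine ⟨η * quadraticChar K w * quadraticChar K (-1), ?_, fun h => ?_⟩
    · rcases hη with rfl | rfl <;> rcases hχw with e | e <;> rcases hχ1 with e' | e' <;>
        simp [e, e']
    · rw [sum_comp_mul_sq hK hw (fun u => quadDeviation k r η (h - u))]
      have hk' : Even (k + 1) := by simpa [Nat.even_add_one] using hk
      simp only [quadDeviation, if_neg (Nat.not_even_iff_odd.2 hk), if_pos hk']
      have h1 : ∀ u : K, (1 + quadraticChar K (u * w)) *
          (η * (Fintype.card K : ℤ) ^ ((k + 1) / 2 + r) * quadraticChar K (h - u)) =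
          η * (Fintype.card K : ℤ) ^ ((k + 1) / 2 + r) * (quadraticChar K (h - u) +
          quadraticChar K w * (quadraticChar K u * quadraticChar K (h - u))) := by
        intro u
        rw [map_mul]
        ring
      have h2 : ∑ u : K, quadraticChar K (h - u) = 0 := by
        rw [← hχ0]; exact (Equiv.subLeft h).sum_comp (fun u => quadraticChar K u)
      simp_rw [h1, ← mul_sum, sum_add_distrib, ← mul_sum, h2, quadraticChar_sum_mul_sub hK]
      ring

theorem card_weighted_sq (hK : ringChar K ≠ 2) (n : ℕ) (w : Fin n → K) :
    ∃ k r : ℕ, ∃ η : ℤ, (η = 1 ∨ η = -1) ∧ k + r = n ∧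
      Nat.card {x : Fin n → K // ∀ i, w i * x i = 0} = Fintype.card K ^ r ∧
      ∀ h : K, (Fintype.card K : ℤ) * Nat.card {x : Fin n → K // ∑ i, w i * x i ^ 2 = h} =
        (Fintype.card K : ℤ) ^ n + quadDeviation k r η h := by
  induction n with
  | zero =>
    refine ⟨0, 0, 1, Or.inl rfl, rfl, by simp, fun h => ?_⟩
    by_cases hh : h = 0 <;> simp [quadDeviation, hh, eq_comm]
  | succ n ih =>
    obtain ⟨k, r, η, hη, hkr, hrad, hN⟩ := ih (fun i => w i.succ)
    have hrad' : ∀ P : K → Prop, Nat.card {x : Fin (n + 1) → K // P (x 0) ∧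
        ∀ i : Fin n, w i.succ * x i.succ = 0} = Nat.card {t : K // P t} * Fintype.card K ^ r := by
      intro P
      rw [← hrad, ← Nat.card_prod]
      refine Nat.card_congr ⟨fun x => ⟨⟨x.1 0, x.2.1⟩, ⟨fun i => x.1 i.succ, x.2.2⟩⟩,
        fun y => ⟨Fin.cons y.1.1 y.2.1, by simpa only [Fin.cons_zero, Fin.cons_succ] using ⟨y.1.2, y.2.2⟩⟩, fun x => ?_, fun y => ?_⟩
      · ext i; refine Fin.cases ?_ (fun i => ?_) i <;> simp
      · rfl
    simp_rw [Fin.forall_fin_succ, card_weighted_sq_cons w, Nat.cast_sum, mul_sum, hN,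
      sum_add_distrib]
    by_cases hw : w 0 = 0
    · refine ⟨k, r + 1, η, hη, by omega, ?_, fun h => ?_⟩
      · rw [hrad' (fun t => w 0 * t = 0)]
        simp [hw, pow_succ, mul_comm]
      · simp [hw, quadDeviation_succ_right]
        ring
    · obtain ⟨η', hη', hsum⟩ := sum_quadDeviation_sub_mul_sq hK hw k r hη
      refine ⟨k + 1, r, η', hη', by omega, ?_, fun h => ?_⟩
      · rw [hrad' (fun t => w 0 * t = 0)]
        simp [hw]
      · rw [hsum]
        simp
        ring

theorem QuadraticForm.card_fiber (hK : ringChar K ≠ 2) {V : Type*} [AddCommGroup V] [Module K V]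
    [FiniteDimensional K V] (Q : QuadraticForm K V) :
    ∃ k r : ℕ, ∃ η : ℤ, (η = 1 ∨ η = -1) ∧ k + r = Module.finrank K V ∧
      Nat.card (polarRadical Q) = Fintype.card K ^ r ∧
      ∀ h : K, (Fintype.card K : ℤ) * Nat.card {x : V // Q x = h} =
        (Fintype.card K : ℤ) ^ Module.finrank K V + quadDeviation k r η h := by
  -- Invertibility of 2 is needed both to diagonalize and to identify the radical with the vectors
  -- satisfying `w i * x i = 0`.
  have h2 : (2 : K) ≠ 0 := Ring.two_ne_zero hK
  have : Invertible (2 : K) := invertibleOfNonzero h2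
  obtain ⟨w, ⟨e⟩⟩ := QuadraticForm.equivalent_weightedSumSquares Q
  obtain ⟨k, r, η, hη, hkr, hrad, hN⟩ := card_weighted_sq hK _ w
  refine ⟨k, r, η, hη, hkr, ?_, fun h => ?_⟩
  · rw [← hrad]
    refine Nat.card_congr (e.toLinearEquiv.toEquiv.subtypeEquiv fun x => ?_)
    have hp : ∀ y, QuadraticMap.polar Q x y =
        QuadraticMap.polar (QuadraticMap.weightedSumSquares K w) (e x) (e y) := by
      intro y
      simp only [QuadraticMap.polar, ← map_add, e.map_app]
    have hs : (∀ y, QuadraticMap.polar Q x y = 0) ↔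
        ∀ y, QuadraticMap.polar (QuadraticMap.weightedSumSquares K w) (e x) y = 0 := by
      constructor
      · intro H y
        have := H (e.symm y)
        rwa [hp, e.apply_symm_apply] at this
      · intro H y
        rw [hp, H]
    rw [mem_polarRadical, hs]
    simp only [polar_weightedSumSquares]
    constructor
    · intro H i
      have := H (Pi.single i 1)
      simp [Pi.single_apply] at this
      rcases this with h | h
      · exact absurd h h2
      · simpa using h
    · intro H y
      refine sum_eq_zero fun i _ => ?_
      have := H i
      simp only [LinearEquiv.coe_toEquiv, QuadraticMap.IsometryEquiv.coe_toLinearEquiv] at this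
      rw [this]; simp
  · rw [← hN h]
    congr 2
    refine Nat.card_congr (e.toLinearEquiv.toEquiv.subtypeEquiv fun x => ?_)
    have := e.map_app x
    rw [QuadraticMap.weightedSumSquares_apply] at this
    simp only [LinearEquiv.coe_toEquiv, QuadraticMap.IsometryEquiv.coe_toLinearEquiv]
    rw [← this]
    simp [pow_two]

end QuadraticCounting

/-! ### Zeros of a quadratic form plus a linear form and a constant. -/

section AffineQuadratic

open Finset

variable {K V : Type*} [Field K] [AddCommGroup V] [Module K V]

theorem QuadraticForm.card_add_polar (Q : QuadraticForm K V) (c : V) (h : K) :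
    Nat.card {x : V // Q x + Q.polarBilin c x + h = 0} = Nat.card {x : V // Q x = Q c - h} := by
  refine Nat.card_congr ((Equiv.addRight c).subtypeEquiv fun x => ?_)
  have : Q (x + c) = Q x + Q.polarBilin c x + Q c := by
    simp only [QuadraticMap.polarBilin_apply_apply, QuadraticMap.polar, add_comm c x]
    ring
  simp only [Equiv.coe_addRight, this]
  constructor <;> intro H <;> linear_combination H

/-- `Q` is invariant under translation by `z`, so the function is affine with slope `φ z ≠ 0` on
each line in direction `z`, and vanishes exactly once there. -/
theorem QuadraticForm.card_add_of_mem_polarRadical [Fintype K] (h2 : (2 : K) ≠ 0) (Q : QuadraticForm K V)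
    (φ : Module.Dual K V) {z : V} (hz : z ∈ polarRadical Q) (hφ : φ z ≠ 0) (h : K) :
    Fintype.card K * Nat.card {x : V // Q x + φ x + h = 0} = Nat.card V := by
  have hQz : Q z = 0 := by
    have := mem_polarRadical.1 hz z
    rw [QuadraticMap.polar_self] at this
    simpa [h2] using this
  have hadd : ∀ x t, Q (x + t • z) + φ (x + t • z) + h = Q x + φ x + h + t * φ z := by
    intro x t
    have h1 : QuadraticMap.polar Q x z = 0 := by
      rw [QuadraticMap.polar_comm]; exact mem_polarRadical.1 hz x
    rw [QuadraticMap.map_add Q, QuadraticMap.polar_smul_right, h1, QuadraticMap.map_smul, hQz]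
    simp
    ring
  rw [← Nat.card_eq_fintype_card, ← Nat.card_prod]
  refine Nat.card_congr ⟨fun y => y.2.1 + y.1 • z, fun v => ⟨(Q v + φ v + h) / φ z,
    v + (-((Q v + φ v + h) / φ z)) • z, ?_⟩, fun y => ?_, fun v => ?_⟩
  · rw [hadd]; field_simp; ring
  · have h3 : (Q (y.2.1 + y.1 • z) + φ (y.2.1 + y.1 • z) + h) / φ z = y.1 := by
      rw [hadd, y.2.2]; field_simp; ring
    ext
    · exact h3
    · simp only [h3]; simp
  · simp

/-- By symmetry of the polar form and reflexivity of `V`, the image of the polar map is the whole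
annihilator of its kernel. -/
theorem QuadraticForm.exists_polarRadical_ne_zero [FiniteDimensional K V] (Q : QuadraticForm K V)
    {φ : Module.Dual K V} (hφ : φ ∉ LinearMap.range Q.polarBilin) :
    ∃ z ∈ polarRadical Q, φ z ≠ 0 := by
  by_contra! H
  apply hφ
  have h1 : φ ∈ (LinearMap.ker Q.polarBilin).dualAnnihilator :=
    (Submodule.mem_dualAnnihilator _).2 H
  rw [← LinearMap.range_dualMap_eq_dualAnnihilator_ker] at h1
  obtain ⟨ψ, rfl⟩ := h1
  obtain ⟨c, rfl⟩ := (Module.evalEquiv K V).surjective ψ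
  refine ⟨c, LinearMap.ext fun x => ?_⟩
  simp [QuadraticMap.polar_comm Q c x]

theorem LinearMap.card_range_mul_card_ker {W : Type*} [AddCommGroup W] [Module K W]
    (f : V →ₗ[K] W) :
    Nat.card (LinearMap.range f) * Nat.card (LinearMap.ker f) = Nat.card V := by
  rw [Submodule.card_eq_card_quotient_mul_card (LinearMap.ker f),
    Nat.card_congr f.quotKerEquivRange.toEquiv, mul_comm]

/-- Distribution of the number of zeros of `Q + φ + h`, as the linear form `φ` and the constant `h`
vary. -/
theorem QuadraticForm.card_affine_zeros [Fintype K] [Finite V] (h2 : (2 : K) ≠ 0) (Q : QuadraticForm K V)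
    {s t : ℕ} (hs : s * Nat.card (polarRadical Q) = Nat.card V) (ht : s + t = Nat.card V) {n : ℕ}
    (hn : Fintype.card K * n = Nat.card V) (P : ℕ → Prop) [DecidablePred P] :
    Nat.card {y : Module.Dual K V × K // P (Nat.card {x : V // Q x + y.1 x + y.2 = 0})} =
      s * Nat.card {h : K // P (Nat.card {x : V // Q x = h})} +
        t * if P n then Fintype.card K else 0 := by
  classical
  have : Finite (Module.Dual K V) := DFunLike.finite _
  have := Fintype.ofFinite (Module.Dual K V)
  have e1 : {y : Module.Dual K V × K // P (Nat.card {x : V // Q x + y.1 x + y.2 = 0})} ≃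
      Σ φ : Module.Dual K V, {h : K // P (Nat.card {x : V // Q x + φ x + h = 0})} :=
    ⟨fun y => ⟨y.1.1, y.1.2, y.2⟩, fun y => ⟨(y.1, y.2.1), y.2.2⟩, fun _ => rfl, fun _ => rfl⟩
  rw [Nat.card_congr e1, Nat.card_sigma]
  have h1 : ∀ φ : Module.Dual K V,
      Nat.card {h : K // P (Nat.card {x : V // Q x + φ x + h = 0})} =
      if φ ∈ LinearMap.range Q.polarBilin then Nat.card {h : K // P (Nat.card {x : V // Q x = h})}
      else if P n then Fintype.card K else 0 := by
    intro φ
    by_cases hφ : φ ∈ LinearMap.range Q.polarBilin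
    · rw [if_pos hφ]
      obtain ⟨c, rfl⟩ := hφ
      -- Completing the square replaces the constant `h` by the value `Q c - h`, which again runs
      -- over all of `K`.
      refine Nat.card_congr ((Equiv.subLeft (Q c)).subtypeEquiv fun h => ?_)
      rw [QuadraticForm.card_add_polar]
      simp
    · rw [if_neg hφ]
      obtain ⟨z, hz, hφz⟩ := Q.exists_polarRadical_ne_zero hφ
      have h3 : ∀ h, Nat.card {x : V // Q x + φ x + h = 0} = n := fun h =>
        Nat.eq_of_mul_eq_mul_left Fintype.card_pos
          ((Q.card_add_of_mem_polarRadical h2 φ hz hφz h).trans hn.symm)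
      simp_rw [h3]
      split_ifs with hP <;> simp [hP]
  have hrange : #{φ : Module.Dual K V | φ ∈ LinearMap.range Q.polarBilin} = s := by
    have h3 := LinearMap.card_range_mul_card_ker Q.polarBilin
    have h4 : 0 < Nat.card (polarRadical Q) := Nat.card_pos
    rw [← Nat.eq_of_mul_eq_mul_right h4 (h3.trans hs.symm), Nat.card_eq_fintype_card,
      Fintype.card_subtype]
  have hdual : Nat.card V = Fintype.card (Module.Dual K V) := by
    rw [← Nat.card_eq_fintype_card]
    exact Nat.card_congr (Module.finBasis K V).toDualEquiv.toEquiv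
  have hcompl : #{φ : Module.Dual K V | φ ∉ LinearMap.range Q.polarBilin} = t := by
    have h5 := card_filter_add_card_filter_not (s := univ)
      (fun φ : Module.Dual K V => φ ∈ LinearMap.range Q.polarBilin)
    rw [hrange, card_univ, ← hdual] at h5
    omega
  simp_rw [h1]
  rw [sum_ite]
  simp only [sum_const, hrange, hcompl, smul_eq_mul]

end AffineQuadratic

/-! ### The form `Tr(a x^(p^l+1))` and the equation of its radical. -/

section FrobeniusForm

open Finset

variable (p l : ℕ) [Fact p.Prime] {F : Type*} [Field F] [Algebra (ZMod p) F]

/-- The bilinear form `Tr(a x^(p^l) y)`. -/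
noncomputable def frobeniusBilin (a : F) : LinearMap.BilinForm (ZMod p) F :=
  have : CharP F p := charP_of_injective_algebraMap (algebraMap (ZMod p) F).injective p
  LinearMap.mk₂ (ZMod p) (fun x y => Algebra.trace (ZMod p) F (a * x ^ p ^ l * y))
    (fun x x' y => by rw [add_pow_char_pow, ← map_add]; ring_nf)
    (fun t x y => by
      rw [smul_pow, ZMod.pow_card_pow, ← map_smul, mul_smul_comm, smul_mul_assoc])
    (fun x y y' => by rw [← map_add]; ring_nf)
    (fun t x y => by rw [← map_smul, mul_smul_comm])

/-- The quadratic form `Tr(a x^(p^l+1))`. -/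
noncomputable def frobeniusForm (a : F) : QuadraticForm (ZMod p) F :=
  (frobeniusBilin p l a).toQuadraticMap

theorem frobeniusForm_apply (a x : F) :
    frobeniusForm p l a x = Algebra.trace (ZMod p) F (a * x ^ (p ^ l + 1)) := by
  change Algebra.trace (ZMod p) F (a * x ^ p ^ l * x) = _
  rw [pow_succ, mul_assoc]

theorem polar_frobeniusForm (a x y : F) :
    QuadraticMap.polar (frobeniusForm p l a) x y =
      Algebra.trace (ZMod p) F (a * x ^ p ^ l * y + a * y ^ p ^ l * x) := by
  rw [frobeniusForm, LinearMap.BilinMap.polar_toQuadraticMap, map_add]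
  rfl

variable [Fintype F]

theorem trace_pow_card_pow (z : F) :
    Algebra.trace (ZMod p) F (z ^ p ^ l) = Algebra.trace (ZMod p) F z := by
  induction l with
  | zero => simp
  | succ l ih =>
    rw [← ih, pow_succ, pow_mul]
    have := Algebra.trace_eq_of_algEquiv
      (FiniteField.frobeniusAlgEquivOfAlgebraic (ZMod p) F) (z ^ p ^ l)
    simpa [FiniteField.coe_frobeniusAlgEquivOfAlgebraic, ZMod.card] using this

/-- Raising `a c^(p^l) y` to the power `p^l` keeps its trace, so both polar terms become multiples
of `y^(p^l)`. The trace form is nondegenerate and Frobenius is surjective, so the common coefficient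
must vanish. -/
theorem mem_polarRadical_frobeniusForm (a c : F) :
    c ∈ polarRadical (frobeniusForm p l a) ↔ a ^ p ^ l * c ^ (p ^ l * p ^ l) + a * c = 0 := by
  have : CharP F p := charP_of_injective_algebraMap (algebraMap (ZMod p) F).injective p
  have hpol : ∀ y, QuadraticMap.polar (frobeniusForm p l a) c y =
      Algebra.trace (ZMod p) F ((a ^ p ^ l * c ^ (p ^ l * p ^ l) + a * c) * y ^ p ^ l) := by
    intro y
    rw [polar_frobeniusForm, map_add, ← trace_pow_card_pow p l (a * c ^ p ^ l * y), ← map_add]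
    congr 1
    rw [mul_pow, mul_pow, ← pow_mul]
    ring
  rw [mem_polarRadical]
  simp_rw [hpol]
  constructor
  · intro H
    refine (traceForm_nondegenerate (ZMod p) F).1 _ fun y => ?_
    obtain ⟨z, rfl⟩ := (bijective_iterateFrobenius F p l).2 y
    rw [iterateFrobenius_def]
    exact H z
  · intro H y
    rw [H]; simp

theorem mem_polarRadical_frobeniusForm_of_ne_zero (a : F) {c : F} (hc : c ≠ 0) :
    c ∈ polarRadical (frobeniusForm p l a) ↔
      (a * c ^ (p ^ l + 1)) ^ p ^ l = -(a * c ^ (p ^ l + 1)) := by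
  rw [mem_polarRadical_frobeniusForm, ← mul_eq_zero_iff_right (pow_ne_zero (p ^ l) hc),
    eq_neg_iff_add_eq_zero]
  ring_nf

end FrobeniusForm

/-! ### Roots of unity and of -1 in a finite field. -/

section FiniteFieldCounting

open Finset

variable {F : Type*} [Field F] [Fintype F]

theorem card_units_pow_eq_one (e : ℕ) :
    Nat.card {u : Fˣ // u ^ e = 1} = (Fintype.card F - 1).gcd e := by
  have := IsCyclic.card_powMonoidHom_ker (G := Fˣ) e
  rw [Nat.card_units, Nat.card_eq_fintype_card (α := F)] at this
  exact this

theorem card_pow_eq_self (e : ℕ) :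
    Nat.card {z : F // z ^ (e + 1) = z} = (Fintype.card F - 1).gcd e + 1 := by
  classical
  rw [← card_units_pow_eq_one, ← Finite.card_option]
  refine Nat.card_congr (Equiv.symm ⟨fun o => o.elim ⟨0, by simp⟩ fun u => ⟨u.1, ?_⟩,
    fun z => if h : z.1 = 0 then none else some ⟨Units.mk0 z.1 h, ?_⟩, ?_, ?_⟩)
  · rw [pow_succ, ← Units.val_pow_eq_pow_val, u.2]; simp
  · have h1 : z.1 ^ e * z.1 = 1 * z.1 := by rw [← pow_succ, z.2, one_mul]
    ext
    simpa using mul_right_cancel₀ h h1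
  · rintro (_ | u) <;> simp
  · intro z
    by_cases h : z.1 = 0
    · simp [h, Subtype.ext_iff]
    · simp [h]

theorem Nat.gcd_two_mul_of_dvd {A B : ℕ} (h : 2 * Nat.gcd B A ∣ B) :
    Nat.gcd B (2 * A) = 2 * Nat.gcd B A := by
  apply Nat.dvd_antisymm
  · rw [← Nat.gcd_mul_left]
    exact Nat.dvd_gcd ((Nat.gcd_dvd_left _ _).trans (dvd_mul_left _ _)) (Nat.gcd_dvd_right _ _)
  · exact Nat.dvd_gcd h (Nat.mul_dvd_mul_left 2 (Nat.gcd_dvd_right _ _))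

/-- The solutions of `u^(2e) = 1` split into those with `u^e = 1` and those with `u^e = -1`; the
divisibility hypothesis makes the total twice the first part. -/
theorem card_units_pow_eq_neg_one (h2 : (2 : F) ≠ 0) {e : ℕ}
    (h : 2 * (Fintype.card F - 1).gcd e ∣ Fintype.card F - 1) :
    Nat.card {u : Fˣ // u ^ e = -1} = (Fintype.card F - 1).gcd e := by
  classical
  have h1 := card_units_pow_eq_one (F := F) (2 * e)
  rw [Nat.gcd_two_mul_of_dvd h, ← card_units_pow_eq_one] at h1
  have hne : (1 : Fˣ) ≠ -1 := by
    intro H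
    apply h2
    have h3 := congrArg Units.val H
    simp only [Units.val_one, Units.val_neg] at h3
    linear_combination h3
  have hiff : ∀ u : Fˣ, u ^ (2 * e) = 1 ↔ u ^ e = 1 ∨ u ^ e = -1 := by
    intro u
    rw [mul_comm, pow_mul]
    simp only [Units.ext_iff, Units.val_pow_eq_pow_val, Units.val_one, Units.val_neg]
    exact sq_eq_one_iff
  rw [← card_units_pow_eq_one]
  have h4 : Nat.card {u : Fˣ // u ^ (2 * e) = 1} =
      Nat.card {u : Fˣ // u ^ e = 1} + Nat.card {u : Fˣ // u ^ e = -1} := by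
    simp only [Nat.card_eq_fintype_card, Fintype.card_subtype]
    rw [← card_union_of_disjoint, ← filter_or]
    · simp_rw [hiff]
    · rw [disjoint_filter]
      rintro u - h h'
      exact hne (h.symm.trans h')
  omega

end FiniteFieldCounting

/-! ### Size of the radical, and divisibility of the fibers. -/

section FrobeniusRadical

theorem two_ne_zero_of_odd_char {p : ℕ} [Fact p.Prime] {F : Type*} [Field F] [Algebra (ZMod p) F]
    (hp : Odd p) : (2 : F) ≠ 0 := by
  have : CharP F p := charP_of_injective_algebraMap (algebraMap (ZMod p) F).injective p
  refine Ring.two_ne_zero ?_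
  rw [ringChar.eq F p]
  rintro rfl
  exact absurd hp (by decide)

theorem pow_sub_one_mul_pow_add_one (p l : ℕ) : (p ^ l - 1) * (p ^ l + 1) = p ^ (2 * l) - 1 := by
  rw [mul_comm, ← Nat.sq_sub_sq, ← pow_mul, mul_comm l, one_pow]

open Finset

variable {p m l : ℕ} [Fact p.Prime] {F : Type*} [Field F] [Algebra (ZMod p) F] [Fintype F]

theorem exists_unit_pow_eq_neg_one {a c : F} (ha : a ≠ 0) (hc : c ≠ 0)
    (h : c ∈ polarRadical (frobeniusForm p l a)) : ∃ u : Fˣ, u ^ (p ^ l - 1) = -1 := by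
  rw [mem_polarRadical_frobeniusForm_of_ne_zero p l a hc] at h
  have hy : a * c ^ (p ^ l + 1) ≠ 0 := mul_ne_zero ha (pow_ne_zero _ hc)
  refine ⟨Units.mk0 _ hy, ?_⟩
  ext
  have hP : 0 < p ^ l := pow_pos (Fact.out : p.Prime).pos l
  rw [Units.val_pow_eq_pow_val, Units.val_mk0, Units.val_neg, Units.val_one]
  apply mul_right_cancel₀ hy
  rw [← pow_succ, Nat.sub_add_cancel hP, h, neg_one_mul]

/-- A root of `u^(p^l-1) = -1` has order dividing `p^(2l)-1` and `p^m-1`. As `gcd(m,2l) = 1`, its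
order divides `p-1`, hence `p^l-1`, which forces `1 = -1`. -/
theorem polarRadical_frobeniusForm_eq_bot (hp : Odd p) (hm : Odd m) (hml : Nat.gcd m l = 1)
    (hF : Fintype.card F = p ^ m) {a : F} (ha : a ≠ 0) :
    polarRadical (frobeniusForm p l a) = ⊥ := by
  rw [Submodule.eq_bot_iff]
  intro c hc
  by_contra hc0
  obtain ⟨u, hu⟩ := exists_unit_pow_eq_neg_one ha hc0 hc
  have h1 : u ^ (p ^ (2 * l) - 1) = 1 := by
    rw [← pow_sub_one_mul_pow_add_one, pow_mul, hu]
    exact (hp.pow.add_odd odd_one).neg_one_pow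
  have h2 : u ^ (p ^ m - 1) = 1 := by
    rw [← hF, ← Nat.card_eq_fintype_card, ← Nat.card_units]
    exact pow_card_eq_one'
  have h3 : u ^ (p - 1) = 1 := by
    have hg : Nat.gcd m (2 * l) = 1 :=
      Nat.Coprime.mul_right (Nat.coprime_two_right.2 hm) hml
    have := pow_gcd_eq_one.2 ⟨h2, h1⟩
    rwa [Nat.pow_sub_one_gcd_pow_sub_one, hg, pow_one] at this
  have h4 : u ^ (p ^ l - 1) = 1 := by
    obtain ⟨k, hk⟩ := Nat.sub_one_dvd_pow_sub_one p l
    rw [hk, pow_mul, h3, one_pow]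
  rw [hu] at h4
  have h5 := congrArg Units.val h4
  simp only [Units.val_one, Units.val_neg] at h5
  apply two_ne_zero_of_odd_char (F := F) hp
  linear_combination -h5

theorem card_polarRadical_frobeniusForm (hm : Even m) (hml : Nat.gcd m l = 1)
    (hF : Fintype.card F = p ^ m) {a c : F} (ha : a ≠ 0) (hc : c ≠ 0)
    (h : c ∈ polarRadical (frobeniusForm p l a)) :
    Nat.card (polarRadical (frobeniusForm p l a)) = p ^ 2 := by
  have hp0 : 0 < p := (Fact.out : p.Prime).pos
  have hP : 0 < p ^ (2 * l) := pow_pos hp0 _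
  have hg : Nat.gcd m (2 * l) = 2 := by
    obtain ⟨k, rfl⟩ := hm
    rw [← two_mul, Nat.gcd_mul_left, Nat.Coprime.gcd_eq_one (Nat.Coprime.coprime_mul_left (k := 2) (by rwa [two_mul])), mul_one]
  have h1 := card_pow_eq_self (F := F) (p ^ (2 * l) - 1)
  rw [Nat.sub_add_cancel hP, hF, Nat.pow_sub_one_gcd_pow_sub_one, hg,
    Nat.sub_add_cancel (pow_pos hp0 _)] at h1
  rw [← h1]
  -- Dividing by the known solution `c` turns the radical equation into `z^(p^(2l)) = z`, which has
  -- `p^2` roots because `gcd(m,2l) = 2`.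
  refine (Nat.card_congr ((Equiv.mulLeft₀ c hc).subtypeEquiv fun z => ?_)).symm
  rw [mem_polarRadical_frobeniusForm, ← pow_add, ← two_mul] at h ⊢
  change z ^ p ^ (2 * l) = z ↔ a ^ p ^ l * (c * z) ^ p ^ (2 * l) + a * (c * z) = 0
  have h2 : a ^ p ^ l * (c * z) ^ p ^ (2 * l) + a * (c * z) = a * c * (z - z ^ p ^ (2 * l)) := by
    rw [mul_pow]
    linear_combination z ^ p ^ (2 * l) * h
  rw [h2, mul_eq_zero_iff_left (mul_ne_zero ha hc), sub_eq_zero, eq_comm]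

theorem card_submodule_eq_card_units_add_one (R : Submodule (ZMod p) F) :
    Nat.card R = Nat.card {c : Fˣ // (c : F) ∈ R} + 1 := by
  classical
  rw [← Finite.card_option]
  refine Nat.card_congr ⟨fun z => if h : z.1 = 0 then none else some ⟨Units.mk0 z.1 h, z.2⟩,
    fun o => o.elim 0 fun u => ⟨u.1, u.2⟩, ?_, ?_⟩
  · intro z
    by_cases h : z.1 = 0
    · simp [h, Subtype.ext_iff]
    · simp [h]
  · rintro (_ | u) <;> simp

/-- Double counting: `(a,c) ↦ (a c^(p^l+1), c)` matches the pairs with `c ≠ 0` in the radical to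
pairs of a root of `u^(p^l-1) = -1` and an arbitrary unit. The zero vectors add one for each `a`. -/
theorem sum_card_polarRadical_frobeniusForm (hp : Odd p) (hm : Even m) (hml : Nat.gcd m l = 1)
    (hF : Fintype.card F = p ^ m) [DecidableEq F] :
    ∑ a : Fˣ, Nat.card (polarRadical (frobeniusForm p l (a : F))) = p * (p ^ m - 1) := by
  have hp0 : 0 < p := (Fact.out : p.Prime).pos
  have hP : 0 < p ^ l := pow_pos hp0 _
  have hunits : Fintype.card Fˣ = p ^ m - 1 := by rw [Fintype.card_units, hF]
  have hg : (Fintype.card F - 1).gcd (p ^ l - 1) = p - 1 := by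
    rw [hF, Nat.pow_sub_one_gcd_pow_sub_one, hml, pow_one]
  have hY : Nat.card {u : Fˣ // u ^ (p ^ l - 1) = -1} = p - 1 := by
    rw [← hg]
    apply card_units_pow_eq_neg_one (two_ne_zero_of_odd_char (p := p) hp)
    rw [hg, hF]
    obtain ⟨k, rfl⟩ := hm
    rw [← two_mul, pow_mul]
    refine dvd_trans ?_ (Nat.sub_one_dvd_pow_sub_one (p ^ 2) k)
    have := Nat.sq_sub_sq p 1
    rw [one_pow] at this
    rw [this]
    exact Nat.mul_dvd_mul (hp.add_odd odd_one).two_dvd dvd_rfl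
  simp_rw [card_submodule_eq_card_units_add_one, sum_add_distrib]
  rw [← Nat.card_sigma]
  have h1 : Nat.card ((a : Fˣ) × {c : Fˣ // (c : F) ∈ polarRadical (frobeniusForm p l (a : F))}) =
      Nat.card ({u : Fˣ // u ^ (p ^ l - 1) = -1} × Fˣ) := by
    have hiff : ∀ a c : Fˣ, (c : F) ∈ polarRadical (frobeniusForm p l (a : F)) ↔
        (a * c ^ (p ^ l + 1)) ^ (p ^ l - 1) = -1 := by
      intro a c
      rw [mem_polarRadical_frobeniusForm_of_ne_zero p l _ c.ne_zero,
        ← mul_left_inj (a * c ^ (p ^ l + 1)), ← pow_succ, Nat.sub_add_cancel hP, neg_one_mul,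
        Units.ext_iff]
      simp
    rw [← Nat.card_congr (Equiv.subtypeProdEquivSigmaSubtype fun a c : Fˣ =>
      (c : F) ∈ polarRadical (frobeniusForm p l (a : F)))]
    refine Nat.card_congr ⟨fun x => (⟨x.1.1 * x.1.2 ^ (p ^ l + 1), (hiff _ _).1 x.2⟩, x.1.2),
      fun y => ⟨(y.1.1 * (y.2 ^ (p ^ l + 1))⁻¹, y.2), (hiff _ _).2 ?_⟩, ?_, ?_⟩
    · rw [inv_mul_cancel_right, y.1.2]
    · rintro ⟨⟨a, c⟩, h⟩
      simp only [mul_inv_cancel_right]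
    · rintro ⟨⟨u, hu⟩, c⟩
      simp only [inv_mul_cancel_right]
  rw [h1, Nat.card_prod, hY, Nat.card_eq_fintype_card]
  simp only [sum_const, card_univ, smul_eq_mul, mul_one, hunits]
  obtain ⟨p', rfl⟩ : ∃ p', p = p' + 1 := ⟨p - 1, by omega⟩
  rw [Nat.add_sub_cancel]
  ring

/-- Since `l` is odd, `p+1` divides `p^l+1`, so multiplying `x` by a `(p+1)`-th root of unity
preserves the form. Since `m` is even, there are `p+1` such roots, and they act freely on nonzero
`x`. -/
theorem add_one_dvd_card_frobeniusForm_fiber (hm : Even m) (hl : Odd l)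
    (hF : Fintype.card F = p ^ m) (a : F) {h : ZMod p} (hh : h ≠ 0) :
    p + 1 ∣ Nat.card {x : F // frobeniusForm p l a x = h} := by
  classical
  have hμ : #{z : Fˣ | z ^ (p + 1) = 1} = p + 1 := by
    have h1 := card_units_pow_eq_one (F := F) (p + 1)
    have h2 : p + 1 ∣ Fintype.card F - 1 := by
      rw [hF]
      obtain ⟨k, rfl⟩ := hm
      rw [← two_mul, pow_mul]
      refine dvd_trans ?_ (Nat.sub_one_dvd_pow_sub_one (p ^ 2) k)
      have := Nat.sq_sub_sq p 1
      rw [one_pow] at this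
      rw [this]
      exact dvd_mul_right _ _
    rw [Nat.gcd_eq_right h2, Nat.card_eq_fintype_card, Fintype.card_subtype] at h1
    exact h1
  have hdvd : p + 1 ∣ p ^ l + 1 := by simpa using hl.nat_add_dvd_pow_add_pow p 1
  obtain ⟨e, he⟩ := hdvd
  rw [Nat.card_eq_fintype_card, Fintype.card_subtype,
    card_eq_sum_card_image (fun x : F => x ^ (p + 1))]
  refine dvd_sum fun b hb => ?_
  obtain ⟨x, hx, rfl⟩ := mem_image.1 hb
  simp only [mem_filter, mem_univ, true_and, frobeniusForm_apply] at hx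
  have hx0 : x ≠ 0 := by
    rintro rfl
    apply hh
    rw [← hx]; simp
  refine dvd_of_eq (hμ.symm.trans ?_)
  refine card_bij' (fun z _ => x * z) (fun y _ => if hy : y = 0 then 1 else
    Units.mk0 (y / x) (div_ne_zero hy hx0)) ?_ ?_ ?_ ?_
  · intro z hz
    simp only [mem_filter, mem_univ, true_and, frobeniusForm_apply] at hz ⊢
    have hz' : (z : F) ^ (p + 1) = 1 := by rw [← Units.val_pow_eq_pow_val, hz]; rfl
    refine ⟨?_, ?_⟩
    · rw [mul_pow, he, pow_mul (z : F), hz', one_pow, mul_one, ← he, hx]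
    · rw [mul_pow, hz', mul_one]
  · intro y hy
    simp only [mem_filter, mem_univ, true_and] at hy ⊢
    have hy0 : y ≠ 0 := by
      rintro rfl
      have := hy.2
      rw [zero_pow (by omega)] at this
      exact pow_ne_zero _ hx0 this.symm
    ext
    simp only [dif_neg hy0, Units.val_pow_eq_pow_val, Units.val_mk0, Units.val_one, div_pow]
    rw [hy.2, div_self (pow_ne_zero _ hx0)]
  · intro z hz
    ext
    simp [hx0]
  · intro y hy
    simp only [mem_filter, mem_univ, true_and] at hy
    have hy0 : y ≠ 0 := by
      rintro rfl
      have := hy.2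
      rw [zero_pow (by omega)] at this
      exact pow_ne_zero _ hx0 this.symm
    simp only [dif_neg hy0, Units.val_mk0]
    field_simp

end FrobeniusRadical

/-! ### Explicit fiber sizes of the trace form. -/

section FrobeniusFibers

open Finset

variable {p m l : ℕ} [Fact p.Prime] {F : Type*} [Field F] [Algebra (ZMod p) F] [Fintype F]

theorem finrank_of_card_eq (hF : Fintype.card F = p ^ m) : Module.finrank (ZMod p) F = m := by
  have h := Module.card_eq_pow_finrank (K := ZMod p) (V := F)
  rw [hF, ZMod.card] at h
  exact (Nat.pow_right_injective (Fact.out : p.Prime).two_le h).symm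

theorem ringChar_zmod_ne_two (hp : Odd p) : ringChar (ZMod p) ≠ 2 := by
  rw [ZMod.ringChar_zmod_n]
  rintro rfl
  exact absurd hp (by decide)

theorem card_frobeniusForm_fiber_of_odd (hp : Odd p) (hm : Odd m) (hml : Nat.gcd m l = 1)
    (hF : Fintype.card F = p ^ m) {a : F} (ha : a ≠ 0) :
    ∃ η : ℤ, (η = 1 ∨ η = -1) ∧ ∀ h : ZMod p,
      (Nat.card {x : F // frobeniusForm p l a x = h} : ℤ) =
        p ^ (m - 1) + η * p ^ ((m - 1) / 2) * quadraticChar (ZMod p) h := by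
  have hp1 : 1 < p := (Fact.out : p.Prime).one_lt
  obtain ⟨k, r, η, hη, hkr, hR, hN⟩ :=
    QuadraticForm.card_fiber (ringChar_zmod_ne_two hp) (frobeniusForm p l a)
  rw [polarRadical_frobeniusForm_eq_bot hp hm hml hF ha, ZMod.card] at hR
  have hr : r = 0 := by
    by_contra hr
    have := Nat.one_lt_pow hr hp1
    simp at hR
    omega
  subst hr
  rw [finrank_of_card_eq hF] at hkr hN
  obtain rfl : k = m := hkr
  refine ⟨η, hη, fun h => ?_⟩
  have h1 := hN h
  rw [quadDeviation, if_neg (Nat.not_even_iff_odd.2 hm), ZMod.card] at h1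
  have hp0 : (p : ℤ) ≠ 0 := by exact_mod_cast (by omega : p ≠ 0)
  apply mul_left_cancel₀ hp0
  rw [h1]
  obtain ⟨n, rfl⟩ := hm
  have e1 : (2 * n + 1 + 1) / 2 = n + 1 := by omega
  have e2 : (2 * n + 1 - 1) / 2 = n := by omega
  rw [e1, e2, Nat.add_sub_cancel]
  ring

theorem eq_neg_one_pow_of_dvd {n e : ℕ} (hn : 3 ≤ n) {η : ℤ} (hη : η = 1 ∨ η = -1)
    (h : (n : ℤ) ∣ 1 - η * (-1) ^ e) : η = (-1) ^ e := by
  have h2 : ¬ (n : ℤ) ∣ 2 := by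
    intro h
    have := Int.le_of_dvd two_pos h
    omega
  rcases hη with rfl | rfl <;> rcases neg_one_pow_eq_or ℤ e with he | he <;> rw [he] at h ⊢ <;>
    norm_num at h h2 <;> exact absurd h h2

theorem card_frobeniusForm_fiber_of_even (hp : Odd p) (hm : Even m) (hm0 : m ≠ 0)
    (hml : Nat.gcd m l = 1) (hF : Fintype.card F = p ^ m) {a : F} (ha : a ≠ 0) :
    ∃ r : ℕ, (r = 0 ∨ r = 1) ∧
      Nat.card (polarRadical (frobeniusForm p l a)) = p ^ (2 * r) ∧ ∀ h : ZMod p,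
      (Nat.card {x : F // frobeniusForm p l a x = h} : ℤ) =
        p ^ (m - 1) + (-1) ^ (m / 2 + r) * p ^ (m / 2 - 1 + r) * (if h = 0 then (p - 1 : ℤ) else -1) := by
  have hp1 : 1 < p := (Fact.out : p.Prime).one_lt
  have hp3 : 3 ≤ p := by
    rcases hp with ⟨n, rfl⟩; omega
  have hlodd : Odd l := by
    by_contra h
    rw [Nat.not_odd_iff_even] at h
    have := Nat.dvd_gcd hm.two_dvd h.two_dvd
    rw [hml] at this
    omega
  obtain ⟨k, r', η, hη, hkr, hR, hN⟩ :=
    QuadraticForm.card_fiber (ringChar_zmod_ne_two hp) (frobeniusForm p l a)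
  rw [ZMod.card] at hR
  obtain ⟨r, hr, rfl⟩ : ∃ r, (r = 0 ∨ r = 1) ∧ r' = 2 * r := by
    by_cases hc : ∃ c, c ≠ 0 ∧ c ∈ polarRadical (frobeniusForm p l a)
    · obtain ⟨c, hc, hcR⟩ := hc
      rw [card_polarRadical_frobeniusForm hm hml hF ha hc hcR] at hR
      exact ⟨1, Or.inr rfl, (Nat.pow_right_injective hp1 hR).symm⟩
    · have hbot : polarRadical (frobeniusForm p l a) = ⊥ := by
        rw [Submodule.eq_bot_iff]
        intro c hcR
        by_contra h
        exact hc ⟨c, h, hcR⟩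
      refine ⟨0, Or.inl rfl, ?_⟩
      rw [hbot] at hR
      by_contra hr
      have := Nat.one_lt_pow hr hp1
      simp at hR
      omega
  refine ⟨r, hr, hR, ?_⟩
  rw [finrank_of_card_eq hF] at hkr hN
  obtain ⟨n, rfl⟩ : ∃ n, m = 2 * (n + 1) := by
    obtain ⟨n, rfl⟩ := hm
    exact ⟨n - 1, by omega⟩
  have hk : Even k := by
    have : k = 2 * (n + 1 - r) := by omega
    rw [this]; exact even_two_mul _
  have e1 : k / 2 + 2 * r = n + 1 + r := by omega
  have e2 : 2 * (n + 1) / 2 = n + 1 := by omega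
  have e3 : 2 * (n + 1) - 1 = 2 * n + 1 := by omega
  simp only [quadDeviation, if_pos hk, ZMod.card, e1] at hN
  -- Reduce the count over `h = 1` modulo `p+1`, where `p ≡ -1`: the wrong sign would make `p+1 ≥ 4`
  -- divide 2.
  have hsign : η = (-1) ^ (n + 1 + r) := by
    apply eq_neg_one_pow_of_dvd (n := p + 1) (by omega) hη
    have h1 := hN 1
    rw [if_neg one_ne_zero] at h1
    have h2 : ((p + 1 : ℕ) : ℤ) ∣ Nat.card {x : F // frobeniusForm p l a x = 1} :=
      Int.natCast_dvd_natCast.2 (add_one_dvd_card_frobeniusForm_fiber hm hlodd hF a one_ne_zero)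
    have h3 := h2.mul_left (p : ℤ)
    rw [h1] at h3
    have h4 : (p : ℤ) ≡ -1 [ZMOD ((p + 1 : ℕ) : ℤ)] :=
      (Int.modEq_iff_dvd.2 ⟨-1, by push_cast; ring⟩)
    have h5 := ((h4.pow (2 * (n + 1))).add (((h4.pow (n + 1 + r)).mul_left η).mul_right (0 - 1)))
    have h6 := h5.symm.trans (Int.modEq_zero_iff_dvd.2 h3)
    have h7 := Int.modEq_zero_iff_dvd.1 h6
    rw [pow_mul (-1 : ℤ), neg_one_sq, one_pow] at h7
    convert h7 using 1
    ring
  intro h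
  have hp0 : (p : ℤ) ≠ 0 := by exact_mod_cast (by omega : p ≠ 0)
  apply mul_left_cancel₀ hp0
  rw [hN h, hsign, e2, e3, Nat.add_sub_cancel]
  split_ifs <;> ring

end FrobeniusFibers

/-! ### Counting field elements by the value of a fiber size. -/

section CountingValues

open Finset

variable {p : ℕ} [Fact p.Prime]

theorem card_subtype_ite_zero (X Y : ℤ) (P : ℤ → Prop) [DecidablePred P] :
    (Nat.card {h : ZMod p // P (if h = 0 then X else Y)} : ℚ) =
      (if P X then 1 else 0) + (p - 1) * if P Y then 1 else 0 := by
  rw [Nat.card_eq_fintype_card, Fintype.card_subtype, card_filter, Nat.cast_sum,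
    ← add_sum_erase univ _ (mem_univ (0 : ZMod p))]
  rw [sum_congr rfl (g := fun _ => (if P Y then 1 else 0 : ℚ))]
  · have h1 : ((p - 1 : ℕ) : ℚ) = p - 1 := Nat.cast_pred (Fact.out : p.Prime).pos
    rw [sum_const, card_erase_of_mem (mem_univ _), card_univ, ZMod.card, nsmul_eq_mul, h1]
    simp
  · intro h hh
    rw [if_neg (ne_of_mem_erase hh)]
    push_cast
    rfl

theorem card_subtype_quadraticChar (hp : Odd p) (X Y : ℤ) (P : ℤ → Prop) [DecidablePred P] :
    (Nat.card {h : ZMod p // P (X + Y * quadraticChar (ZMod p) h)} : ℚ) =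
      (if P X then 1 else 0) +
        (p - 1) / 2 * ((if P (X + Y) then 1 else 0) + if P (X - Y) then 1 else 0) := by
  have hs : (∑ h : ZMod p, (quadraticChar (ZMod p) h : ℚ)) = 0 := by
    have h := quadraticChar_sum_zero (ringChar_zmod_ne_two hp)
    exact_mod_cast h
  have h1 : ((p - 1 : ℕ) : ℚ) = p - 1 := Nat.cast_pred (Fact.out : p.Prime).pos
  rw [Nat.card_eq_fintype_card, Fintype.card_subtype, card_filter, Nat.cast_sum,
    ← add_sum_erase univ _ (mem_univ (0 : ZMod p))]
  rw [← add_sum_erase univ _ (mem_univ (0 : ZMod p)), quadraticChar_zero, Int.cast_zero,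
    zero_add] at hs
  -- On nonzero `h` the character is `±1`, so the indicator is an affine function of it, and the
  -- character sum vanishes.
  rw [sum_congr rfl (g := fun h => ((if P (X + Y) then 1 else 0 : ℚ) +
    (if P (X - Y) then 1 else 0)) / 2 + ((if P (X + Y) then 1 else 0 : ℚ) -
    (if P (X - Y) then 1 else 0)) / 2 * (quadraticChar (ZMod p) h : ℚ))]
  · rw [sum_add_distrib, ← mul_sum, hs, sum_const, card_erase_of_mem (mem_univ _), card_univ,
      ZMod.card, nsmul_eq_mul, h1, quadraticChar_zero]
    simp
    ring
  · intro h hh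
    rcases quadraticChar_dichotomy (ne_of_mem_erase hh) with e | e <;> rw [e] <;> push_cast
    · simp only [mul_one]; ring
    · simp only [mul_neg, mul_one, ← sub_eq_add_neg]; ring

end CountingValues

/-! ### Zero counts over all triples `(a,b,h)`. -/

section TraceTriples

open Finset

variable {p m l : ℕ} [Fact p.Prime] {F : Type*} [Field F] [Algebra (ZMod p) F] [Fintype F]

/-- The number of zeros of `Tr(a x^(p^l+1) + b x) + h`. -/
noncomputable def affineZeros (p l : ℕ) [Fact p.Prime] {F : Type*} [Field F] [Algebra (ZMod p) F]
    (a b : F) (h : ZMod p) : ℕ :=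
  Nat.card {x : F // Algebra.trace (ZMod p) F (a * x ^ (p ^ l + 1) + b * x) + h = 0}

theorem card_affineZeros (hp : Odd p) (hm : m ≠ 0) (hF : Fintype.card F = p ^ m) (a : F) {s t : ℕ}
    (hs : s * Nat.card (polarRadical (frobeniusForm p l a)) = p ^ m) (ht : s + t = p ^ m)
    (P : ℤ → Prop) [DecidablePred P] :
    (Nat.card {y : F × ZMod p // P (affineZeros p l a y.1 y.2)} : ℚ) =
      s * Nat.card {h : ZMod p // P (Nat.card {x : F // frobeniusForm p l a x = h})} +
        t * p * if P ((p : ℤ) ^ (m - 1)) then 1 else 0 := by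
  have h2 : (2 : ZMod p) ≠ 0 := two_ne_zero_of_odd_char (p := p) hp
  have hV : Nat.card F = p ^ m := by rw [Nat.card_eq_fintype_card, hF]
  have hn : Fintype.card (ZMod p) * p ^ (m - 1) = Nat.card F := by
    rw [ZMod.card, hV, ← pow_succ', Nat.sub_add_cancel (Nat.one_le_iff_ne_zero.2 hm)]
  have key := QuadraticForm.card_affine_zeros h2 (frobeniusForm p l a) (hs.trans hV.symm)
    (ht.trans hV.symm) hn (fun n => P n)
  have e : Nat.card {y : F × ZMod p // P (affineZeros p l a y.1 y.2)} =
      Nat.card {y : Module.Dual (ZMod p) F × ZMod p //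
        P (Nat.card {x : F // frobeniusForm p l a x + y.1 x + y.2 = 0})} := by
    -- By nondegeneracy of the trace form, `b ↦ Tr(b x)` runs over every linear form exactly once.
    refine Nat.card_congr (((((Algebra.traceForm (ZMod p) F).toDual
      (traceForm_nondegenerate (ZMod p) F)).toEquiv.prodCongr (Equiv.refl _))).subtypeEquiv
        fun y => ?_)
    have : ∀ x, frobeniusForm p l a x + ((Algebra.traceForm (ZMod p) F).toDual
        (traceForm_nondegenerate (ZMod p) F)) y.1 x + y.2 =
        Algebra.trace (ZMod p) F (a * x ^ (p ^ l + 1) + y.1 * x) + y.2 := by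
      intro x
      rw [LinearMap.BilinForm.toDual_def, Algebra.traceForm_apply, frobeniusForm_apply, map_add]
    simp only [affineZeros, Equiv.prodCongr_apply, Prod.map_fst, Prod.map_snd,
      LinearEquiv.coe_toEquiv, Equiv.refl_apply, this]
  rw [e, key, ZMod.card]
  push_cast
  split_ifs <;> simp

theorem card_affineZeros_zero (hp : Odd p) (hm : m ≠ 0) (hF : Fintype.card F = p ^ m)
    (P : ℤ → Prop) [DecidablePred P] :
    (Nat.card {y : F × ZMod p // P (affineZeros p l 0 y.1 y.2)} : ℚ) =
      (if P ((p : ℤ) ^ m) then 1 else 0) + (p - 1) * (if P 0 then 1 else 0) +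
        (p ^ m - 1) * p * if P ((p : ℤ) ^ (m - 1)) then 1 else 0 := by
  have hV : Nat.card F = p ^ m := by rw [Nat.card_eq_fintype_card, hF]
  have hR : Nat.card (polarRadical (frobeniusForm p l (0 : F))) = p ^ m := by
    rw [← hV]
    refine Nat.card_congr (Equiv.subtypeUnivEquiv fun x => ?_)
    rw [mem_polarRadical_frobeniusForm, zero_pow (pow_ne_zero _ (Fact.out : p.Prime).ne_zero)]
    simp
  have hN : ∀ h : ZMod p, (Nat.card {x : F // frobeniusForm p l 0 x = h} : ℤ) =
      if h = 0 then (p : ℤ) ^ m else 0 := by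
    intro h
    simp only [frobeniusForm_apply, zero_mul, map_zero]
    split_ifs with hh
    · subst hh
      simp [hF]
    · simp [Ne.symm hh]
  have h1 : 1 ≤ p ^ m := Nat.one_le_pow _ _ (Fact.out : p.Prime).pos
  rw [card_affineZeros hp hm hF 0 (s := 1) (t := p ^ m - 1) (by rw [one_mul, hR]) (by omega)]
  simp_rw [hN]
  rw [card_subtype_ite_zero]
  push_cast [Nat.cast_sub h1]
  ring

theorem card_affineZeros_of_odd (hp : Odd p) (hm : Odd m) (hml : Nat.gcd m l = 1)
    (hF : Fintype.card F = p ^ m) {a : F} (ha : a ≠ 0) (P : ℤ → Prop) [DecidablePred P] :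
    (Nat.card {y : F × ZMod p // P (affineZeros p l a y.1 y.2)} : ℚ) =
      p ^ m * ((if P ((p : ℤ) ^ (m - 1)) then 1 else 0) +
        (p - 1) / 2 * ((if P ((p : ℤ) ^ (m - 1) + (p : ℤ) ^ ((m - 1) / 2)) then 1 else 0) +
          if P ((p : ℤ) ^ (m - 1) - (p : ℤ) ^ ((m - 1) / 2)) then 1 else 0)) := by
  have hR := polarRadical_frobeniusForm_eq_bot hp hm hml hF ha
  rw [card_affineZeros hp hm.pos.ne' hF a (s := p ^ m) (t := 0) (by rw [hR]; simp) (by simp)]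
  obtain ⟨η, hη, hN⟩ := card_frobeniusForm_fiber_of_odd hp hm hml hF ha
  simp_rw [hN]
  rw [card_subtype_quadraticChar hp]
  rcases hη with rfl | rfl
  · simp only [one_mul]; push_cast; ring
  · simp only [neg_one_mul, sub_neg_eq_add, ← sub_eq_add_neg]; push_cast; ring

/-- The radical size is 1 or `p^2`, so the two cases combine into one expression affine in that
size. Summing over `a` then needs only the total radical size, not a separate count of each rank. -/
theorem card_affineZeros_of_even (hp : Odd p) (hm : Even m) (hm0 : m ≠ 0) (hml : Nat.gcd m l = 1)
    (hF : Fintype.card F = p ^ m) {a : F} (ha : a ≠ 0) (P : ℤ → Prop) [DecidablePred P] :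
    ((p : ℚ) ^ 2 - 1) * Nat.card {y : F × ZMod p // P (affineZeros p l a y.1 y.2)} =
      (p ^ 2 - Nat.card (polarRadical (frobeniusForm p l a))) * (p ^ m *
        ((if P ((p : ℤ) ^ (m - 1) + (-1) ^ (m / 2) * (p : ℤ) ^ (m / 2 - 1) * (p - 1))
          then 1 else 0) + (p - 1) *
        if P ((p : ℤ) ^ (m - 1) - (-1) ^ (m / 2) * (p : ℤ) ^ (m / 2 - 1)) then 1 else 0)) +
      (Nat.card (polarRadical (frobeniusForm p l a)) - 1) * (p ^ (m - 2) *
        ((if P ((p : ℤ) ^ (m - 1) - (-1) ^ (m / 2) * (p : ℤ) ^ (m / 2) * (p - 1))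
          then 1 else 0) + (p - 1) *
        if P ((p : ℤ) ^ (m - 1) + (-1) ^ (m / 2) * (p : ℤ) ^ (m / 2)) then 1 else 0) +
        (p ^ m - p ^ (m - 2)) * p * if P ((p : ℤ) ^ (m - 1)) then 1 else 0) := by
  obtain ⟨r, hr, hR, hN⟩ := card_frobeniusForm_fiber_of_even hp hm hm0 hml hF ha
  have hm2 : 2 ≤ m := by obtain ⟨k, rfl⟩ := hm; omega
  have hN' : ∀ h : ZMod p, (Nat.card {x : F // frobeniusForm p l a x = h} : ℤ) =
      if h = 0 then (p : ℤ) ^ (m - 1) + (-1) ^ (m / 2 + r) * p ^ (m / 2 - 1 + r) * (p - 1) else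
        (p : ℤ) ^ (m - 1) + (-1) ^ (m / 2 + r) * p ^ (m / 2 - 1 + r) * -1 := by
    intro h
    rw [hN h]
    split_ifs <;> rfl
  rcases hr with rfl | rfl
  · rw [card_affineZeros hp hm0 hF a (s := p ^ m) (t := 0) (by rw [hR]; simp) (by simp)]
    simp_rw [hN']
    rw [card_subtype_ite_zero, hR]
    simp only [add_zero, mul_neg, mul_one, ← sub_eq_add_neg]
    push_cast
    ring
  · have hle : p ^ (m - 2) ≤ p ^ m := Nat.pow_le_pow_right (Fact.out : p.Prime).pos (by omega)
    rw [card_affineZeros hp hm0 hF a (s := p ^ (m - 2)) (t := p ^ m - p ^ (m - 2))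
      (by rw [hR, ← pow_add]; congr 1; omega) (by omega)]
    simp_rw [hN']
    have e : m / 2 - 1 + 1 = m / 2 := by omega
    rw [card_subtype_ite_zero, hR, e]
    simp only [pow_succ (-1 : ℤ), mul_neg, mul_one, neg_mul, neg_neg, ← sub_eq_add_neg]
    push_cast [Nat.cast_sub hle]
    ring

theorem card_triples (P : ℤ → Prop) [DecidableEq F] :
    Nat.card {y : F × F × ZMod p // P (affineZeros p l y.1 y.2.1 y.2.2)} =
      Nat.card {y : F × ZMod p // P (affineZeros p l (0 : F) y.1 y.2)} +
      ∑ a : Fˣ, Nat.card {y : F × ZMod p // P (affineZeros p l (a : F) y.1 y.2)} := by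
  have h1 : Nat.card {y : F × F × ZMod p // P (affineZeros p l y.1 y.2.1 y.2.2)} =
      ∑ a : F, Nat.card {y : F × ZMod p // P (affineZeros p l a y.1 y.2)} := by
    rw [← Nat.card_sigma]
    exact Nat.card_congr (Equiv.subtypeProdEquivSigmaSubtype
      fun (a : F) (y : F × ZMod p) => P (affineZeros p l a y.1 y.2))
  rw [h1, ← add_sum_erase univ _ (mem_univ (0 : F))]
  congr 1
  refine (sum_bij (fun (u : Fˣ) _ => (u : F)) ?_ ?_ ?_ ?_).symm
  · intro u _; simp
  · intro u _ v _ h; exact Units.ext h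
  · intro b hb; exact ⟨Units.mk0 b (ne_of_mem_erase hb), mem_univ _, rfl⟩
  · intro u _; rfl

theorem card_triples_of_odd (hp : Odd p) (hm : Odd m) (hml : Nat.gcd m l = 1)
    (hF : Fintype.card F = p ^ m) (P : ℤ → Prop) [DecidablePred P] :
    (Nat.card {y : F × F × ZMod p // P (affineZeros p l y.1 y.2.1 y.2.2)} : ℚ) =
      (if P ((p : ℤ) ^ m) then 1 else 0) + (p - 1) * (if P 0 then 1 else 0) +
        p * (p ^ (m - 1) + 1) * (p ^ m - 1) * (if P ((p : ℤ) ^ (m - 1)) then 1 else 0) +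
        1 / 2 * p ^ m * (p - 1) * (p ^ m - 1) *
          ((if P ((p : ℤ) ^ (m - 1) + (p : ℤ) ^ ((m - 1) / 2)) then 1 else 0) +
          if P ((p : ℤ) ^ (m - 1) - (p : ℤ) ^ ((m - 1) / 2)) then 1 else 0) := by
  classical
  have h1 : 1 ≤ p ^ m := Nat.one_le_pow _ _ (Fact.out : p.Prime).pos
  have hunits : Fintype.card Fˣ = p ^ m - 1 := by rw [Fintype.card_units, hF]
  rw [card_triples, Nat.cast_add, Nat.cast_sum, card_affineZeros_zero hp hm.pos.ne' hF,
    sum_congr rfl fun (a : Fˣ) _ => card_affineZeros_of_odd hp hm hml hF a.ne_zero P]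
  rw [sum_const, card_univ, hunits, nsmul_eq_mul, Nat.cast_sub h1]
  obtain ⟨n, rfl⟩ := hm
  rw [Nat.add_sub_cancel]
  push_cast
  ring

theorem card_triples_of_even (hp : Odd p) (hm : Even m) (hm0 : m ≠ 0) (hml : Nat.gcd m l = 1)
    (hF : Fintype.card F = p ^ m) (P : ℤ → Prop) [DecidablePred P] :
    (Nat.card {y : F × F × ZMod p // P (affineZeros p l y.1 y.2.1 y.2.2)} : ℚ) =
      (if P ((p : ℤ) ^ m) then 1 else 0) + (p - 1) * (if P 0 then 1 else 0) +
        p * (p ^ (m - 1) - p ^ (m - 2) + 1) * (p ^ m - 1) *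
          (if P ((p : ℤ) ^ (m - 1)) then 1 else 0) +
        p ^ (m + 1) * (p ^ m - 1) / (p + 1) *
          (if P ((p : ℤ) ^ (m - 1) + (-1) ^ (m / 2) * (p : ℤ) ^ (m / 2 - 1) * (p - 1))
            then 1 else 0) +
        p ^ (m + 1) * (p - 1) * (p ^ m - 1) / (p + 1) *
          (if P ((p : ℤ) ^ (m - 1) - (-1) ^ (m / 2) * (p : ℤ) ^ (m / 2 - 1)) then 1 else 0) +
        p ^ (m - 2) * (p ^ m - 1) / (p + 1) *
          (if P ((p : ℤ) ^ (m - 1) - (-1) ^ (m / 2) * (p : ℤ) ^ (m / 2) * (p - 1))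
            then 1 else 0) +
        p ^ (m - 2) * (p - 1) * (p ^ m - 1) / (p + 1) *
          (if P ((p : ℤ) ^ (m - 1) + (-1) ^ (m / 2) * (p : ℤ) ^ (m / 2)) then 1 else 0) := by
  classical
  have hp1 : (1 : ℚ) < p := by exact_mod_cast (Fact.out : p.Prime).one_lt
  have h1 : 1 ≤ p ^ m := Nat.one_le_pow _ _ (Fact.out : p.Prime).pos
  have hunits : Fintype.card Fˣ = p ^ m - 1 := by rw [Fintype.card_units, hF]
  have hsq : (p : ℚ) ^ 2 - 1 ≠ 0 := by nlinarith
  have hR : (∑ a : Fˣ, (Nat.card (polarRadical (frobeniusForm p l (a : F))) : ℚ)) =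
      p * (p ^ m - 1) := by
    have := sum_card_polarRadical_frobeniusForm (l := l) hp hm hml hF
    rw [← Nat.cast_sum, this]
    push_cast [Nat.cast_sub h1]
    ring
  have hsum := sum_congr (s₁ := univ) rfl
    fun (a : Fˣ) _ => card_affineZeros_of_even hp hm hm0 hml hF a.ne_zero P
  rw [← mul_sum, sum_add_distrib, ← sum_mul, ← sum_mul, sum_sub_distrib, sum_sub_distrib, hR,
    sum_const, sum_const, card_univ, hunits, nsmul_eq_mul, nsmul_eq_mul, Nat.cast_sub h1] at hsum
  rw [card_triples, Nat.cast_add, Nat.cast_sum, card_affineZeros_zero hp hm0 hF]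
  apply mul_left_cancel₀ hsq
  rw [mul_add, hsum]
  have hp2 : (p : ℚ) + 1 ≠ 0 := by linarith
  obtain ⟨n, rfl⟩ : ∃ n, m = n + 2 := ⟨m - 2, by obtain ⟨k, rfl⟩ := hm; omega⟩
  have e : n + 2 - 1 = n + 1 := rfl
  rw [Nat.add_sub_cancel, e]
  push_cast
  field_simp
  ring

end TraceTriples

/-! ### From weight tables to distributions of codes. -/

section WeightTables

variable {K ι E : Type*} [Field K] [Fintype ι] [DecidableEq K]

theorem sum_table_eq_zero {T : List (ℤ × ℚ)} {w : ℤ} (hw : w ∉ T.map Prod.fst) :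
    (T.map fun r => r.2 * if w = r.1 then 1 else 0).sum = 0 := by
  induction T with
  | nil => simp
  | cons r T ih =>
    simp only [List.map_cons, List.mem_cons, not_or] at hw
    rw [List.map_cons, List.sum_cons, ih hw.2, if_neg hw.1, mul_zero, add_zero]

theorem sum_table_eq {T : List (ℤ × ℚ)} (hT : (T.map Prod.fst).Nodup) {r : ℤ × ℚ} (hr : r ∈ T) :
    (T.map fun s => s.2 * if r.1 = s.1 then 1 else 0).sum = r.2 := by
  induction T with
  | nil => simp at hr
  | cons s T ih =>
    simp only [List.map_cons, List.nodup_cons] at hT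
    rcases List.mem_cons.1 hr with rfl | hr
    · simp only [List.map_cons, List.sum_cons, sum_table_eq_zero hT.1]
      simp
    · have hne : r.1 ≠ s.1 := by
        rintro h
        exact hT.1 (h ▸ List.mem_map_of_mem hr)
      simp only [List.map_cons, List.sum_cons, ih hT.2 hr]
      simp [hne]

/-- One identity valid for every integer `w` yields both the listed multiplicities and the absence
of other weights; distinctness lets each row be isolated. -/
theorem hasWeightDistribution_of_sum {C : Submodule K (ι → K)} {T : List (ℤ × ℚ)}
    (hT : (T.map Prod.fst).Nodup)
    (h : ∀ w : ℤ, (weightCount C w : ℚ) = (T.map fun r => r.2 * if w = r.1 then 1 else 0).sum) :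
    HasWeightDistribution C T := by
  refine ⟨hT, fun r hr => ?_, fun w hw => ?_⟩
  · rw [h, sum_table_eq hT hr]
  · have := h w
    rw [sum_table_eq_zero hw] at this
    exact_mod_cast this

theorem isKWeightCode_of_hasWeightDistribution {C : Submodule K (ι → K)} {T : List (ℤ × ℚ)} {μ : ℚ}
    (h : HasWeightDistribution C ((0, μ) :: T)) (hμ : ∀ r ∈ T, r.2 ≠ 0) :
    IsKWeightCode C T.length := by
  classical
  obtain ⟨hnd, hrow, hzero⟩ := h
  simp only [List.map_cons, List.nodup_cons] at hnd
  have hrange : ∀ w : ℤ, weightCount C w ≠ 0 → 0 ≤ w ∧ w ≤ Fintype.card ι := by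
    intro w hw
    obtain ⟨c, -, hc⟩ := Set.nonempty_of_ncard_ne_zero hw
    have := hammingNorm_le_card_fintype (x := c)
    omega
  have himg : ((↑) : ℕ → ℤ) '' {i : ℕ | 1 ≤ i ∧ i ≤ codeLength C ∧ weightCount C (i : ℤ) ≠ 0} =
      ((T.map Prod.fst).toFinset : Set ℤ) := by
    ext w
    simp only [Set.mem_image, Set.mem_ofPred_eq, List.coe_toFinset]
    constructor
    · rintro ⟨i, ⟨hi, -, hiw⟩, rfl⟩
      by_contra hn
      refine hiw (hzero _ ?_)
      simp only [List.map_cons, List.mem_cons, not_or]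
      exact ⟨by omega, hn⟩
    · intro hw
      obtain ⟨r, hr, rfl⟩ := List.mem_map.1 hw
      have h1 : weightCount C r.1 ≠ 0 := by
        intro h0
        have := hrow r (List.mem_cons_of_mem _ hr)
        rw [h0] at this
        exact hμ r hr (by exact_mod_cast this.symm)
      have h2 := hrange _ h1
      have h3 : r.1 ≠ 0 := fun h0 => hnd.1 (h0 ▸ hw)
      refine ⟨r.1.toNat, ⟨by omega, ?_, ?_⟩, by omega⟩
      · rw [codeLength]; omega
      · rwa [Int.toNat_of_nonneg h2.1]
  rw [IsKWeightCode, ← Set.ncard_image_of_injective _ (Nat.cast_injective (R := ℤ)), himg,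
    Set.ncard_coe_finset, List.toFinset_card_of_nodup hnd.2, List.length_map]

theorem injective_of_card_weight_zero [AddCommGroup E] [Module K E] (Φ : E →ₗ[K] (ι → K))
    (h : Nat.card {y : E // (hammingNorm (Φ y) : ℤ) = 0} = 1) : Function.Injective Φ := by
  rw [← LinearMap.ker_eq_bot, Submodule.eq_bot_iff]
  intro y hy
  have := (Nat.card_eq_one_iff_unique.1 h).1
  have h1 := Subsingleton.elim (⟨y, by simp [LinearMap.mem_ker.1 hy]⟩ :
    {y : E // (hammingNorm (Φ y) : ℤ) = 0}) ⟨0, by simp⟩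
  exact congrArg Subtype.val h1

theorem weightCount_range [AddCommGroup E] [Module K E] {Φ : E →ₗ[K] (ι → K)}
    (hΦ : Function.Injective Φ) (w : ℤ) :
    weightCount (LinearMap.range Φ) w = Nat.card {y : E // (hammingNorm (Φ y) : ℤ) = w} := by
  rw [weightCount, ← Nat.card_coe_set_eq]
  let f : {y : E // (hammingNorm (Φ y) : ℤ) = w} →
      ↥{c : ι → K | c ∈ LinearMap.range Φ ∧ (hammingNorm c : ℤ) = w} :=
    fun y => ⟨Φ y.1, ⟨y.1, rfl⟩, y.2⟩
  refine (Nat.card_congr (Equiv.ofBijective f ⟨fun y z h => ?_, ?_⟩)).symm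
  · exact Subtype.ext (hΦ (congrArg Subtype.val h))
  · rintro ⟨_, ⟨y, rfl⟩, hy⟩
    exact ⟨⟨y, hy⟩, rfl⟩

end WeightTables

/-! ### The encoder and its weight tables. -/

section TraceCode

variable {p m l : ℕ} [Fact p.Prime] {F : Type*} [Field F] [Algebra (ZMod p) F]

/-- The encoder `(a, b, h) ↦ (Tr(a x^(p^l+1) + b x) + h)_x` of `traceCode`. -/
noncomputable def traceEncoder (p l : ℕ) [Fact p.Prime] (F : Type*) [Field F] [Algebra (ZMod p) F] :
    F × F × ZMod p →ₗ[ZMod p] (F → ZMod p) where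
  toFun y x := Algebra.trace (ZMod p) F (y.1 * x ^ (p ^ l + 1) + y.2.1 * x) + y.2.2
  map_add' y z := by
    ext x
    simp only [Prod.fst_add, Prod.snd_add, Pi.add_apply, add_mul, map_add]
    ring
  map_smul' t y := by
    ext x
    simp only [Prod.smul_fst, Prod.smul_snd, Pi.smul_apply, smul_mul_assoc, map_add, map_smul,
      smul_eq_mul, RingHom.id_apply]
    ring

theorem range_traceEncoder : LinearMap.range (traceEncoder p l F) = traceCode p l F := by
  ext c
  constructor
  · rintro ⟨⟨a, b, h⟩, rfl⟩
    exact ⟨a, b, h, rfl⟩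
  · rintro ⟨a, b, h, rfl⟩
    exact ⟨(a, b, h), rfl⟩

variable [Fintype F]

theorem hammingNorm_traceEncoder (hF : Fintype.card F = p ^ m) (y : F × F × ZMod p) :
    (hammingNorm (traceEncoder p l F y) : ℤ) = p ^ m - affineZeros p l y.1 y.2.1 y.2.2 := by
  have h1 := Finset.card_filter_add_card_filter_not (s := Finset.univ)
    (fun x : F => traceEncoder p l F y x = 0)
  have h2 : affineZeros p l y.1 y.2.1 y.2.2 =
      (Finset.univ.filter fun x : F => traceEncoder p l F y x = 0).card := by
    classical
    rw [affineZeros, Nat.card_eq_fintype_card, Fintype.card_subtype]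
    rfl
  rw [Finset.card_univ, hF, ← h2] at h1
  rw [eq_sub_iff_add_eq, add_comm]
  exact_mod_cast h1

theorem nodup_oddWeightTable (p : ℕ) [Fact p.Prime] (hm : 3 ≤ m) :
    ((oddWeightTable p m).map Prod.fst).Nodup := by
  have hp1 : (1 : ℤ) < p := by exact_mod_cast (Fact.out : p.Prime).one_lt
  have h1 : (p : ℤ) ^ ((m - 1) / 2) < p ^ (m - 1) := pow_lt_pow_right₀ hp1 (by omega)
  have h0 : (0 : ℤ) < p ^ ((m - 1) / 2) := by positivity
  have h2 : (p : ℤ) ^ m = p ^ (m - 1) * (p - 1) + p ^ (m - 1) := by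
    obtain ⟨n, rfl⟩ : ∃ n, m = n + 1 := ⟨m - 1, by omega⟩
    rw [Nat.add_sub_cancel]; ring
  have h3 : (p : ℤ) ^ (m - 1) ≤ p ^ (m - 1) * (p - 1) := by nlinarith
  simp only [oddWeightTable, List.map_cons, List.map_nil, List.nodup_cons, List.mem_cons,
    List.not_mem_nil, or_false, not_or, h2]
  generalize (p : ℤ) ^ (m - 1) * (p - 1) = W at *
  refine ⟨⟨?_, ?_, ?_, ?_⟩, ⟨?_, ?_, ?_⟩, ⟨?_, ?_⟩, ?_, not_false, List.nodup_nil⟩ <;> omega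

theorem nodup_evenWeightTable (hp : Odd p) (hm : 3 ≤ m) (hme : Even m) :
    ((evenWeightTable p m).map Prod.fst).Nodup := by
  have hp1 : (3 : ℤ) ≤ p := by
    have := (Fact.out : p.Prime).two_le
    rcases hp with ⟨n, rfl⟩; push_cast; omega
  obtain ⟨n, rfl⟩ : ∃ n, m = 2 * n + 4 := by
    obtain ⟨k, rfl⟩ := hme
    exact ⟨k - 2, by omega⟩
  have e1 : (2 * n + 4) / 2 = n + 2 := by omega
  have e2 : 2 * n + 4 - 1 = 2 * n + 3 := rfl
  have e3 : n + 2 - 1 = n + 1 := rfl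
  simp only [evenWeightTable, List.map_cons, List.map_nil, List.nodup_cons, List.mem_cons,
    List.not_mem_nil, or_false, not_or, e1, e2, e3]
  set X : ℤ := (p : ℤ) ^ (n + 1) with hX
  have hX1 : 3 ≤ X := hp1.trans (le_self_pow₀ (by omega) (by omega))
  -- This uses `m ≥ 4`; for `m = 2` the weight with `ε p^(m/2)(p-1)` would collapse to 0.
  have hXp : (p : ℤ) ≤ X := le_self_pow₀ (by omega) (by omega)
  have h2 : (p : ℤ) ^ (n + 2) = X * p := by rw [hX]; ring
  have h3 : (p : ℤ) ^ (2 * n + 3) = X * X * p := by rw [hX]; ring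
  have h4 : (p : ℤ) ^ (2 * n + 4) = X * X * p * (p - 1) + X * X * p := by rw [hX]; ring
  rw [h2, h3, h4]
  clear_value X
  have a1 : 2 * X ≤ X * (p - 1) := by nlinarith
  have a2 : 2 * (X * p) ≤ X * p * (p - 1) := by nlinarith
  have a3 : X * (p - 1) = X * p - X := by ring
  have a4 : X * p * (p - 1) < X * X * p := by nlinarith
  have a5 : X * X * p * 2 ≤ X * X * p * (p - 1) := by
    have : 0 ≤ X * X * p := by positivity
    nlinarith
  have a6 : 3 * X ≤ X * p := by nlinarith
  -- With the sign fixed and each product made an atom, distinctness is linear arithmetic from `a1`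
  -- to `a6`.
  rcases neg_one_pow_eq_or ℤ (n + 2) with h | h <;> rw [h] <;>
    simp only [one_mul, neg_mul, sub_neg_eq_add, ← sub_eq_add_neg] <;>
    generalize X * X * p * (p - 1) = W at * <;>
    generalize X * p * (p - 1) = V at * <;>
    generalize X * (p - 1) = U at * <;>
    generalize X * X * p = T at * <;>
    generalize X * p = S at * <;>
    refine ⟨⟨?_, ?_, ?_, ?_, ?_, ?_⟩, ⟨?_, ?_, ?_, ?_, ?_⟩, ⟨?_, ?_, ?_, ?_⟩, ⟨?_, ?_, ?_⟩,
      ⟨?_, ?_⟩, ?_, not_false, List.nodup_nil⟩ <;> omega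

theorem sum_oddWeightTable (hp : Odd p) (hm : Odd m) (hml : Nat.gcd m l = 1)
    (hF : Fintype.card F = p ^ m) (w : ℤ) :
    (Nat.card {y : F × F × ZMod p // (hammingNorm (traceEncoder p l F y) : ℤ) = w} : ℚ) =
      ((oddWeightTable p m).map fun r => r.2 * if w = r.1 then 1 else 0).sum := by
  simp_rw [hammingNorm_traceEncoder hF]
  rw [card_triples_of_odd hp hm hml hF (fun n => (p : ℤ) ^ m - n = w)]
  have h2 : (p : ℤ) ^ m = p ^ (m - 1) * (p - 1) + p ^ (m - 1) := by
    obtain ⟨n, rfl⟩ := hm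
    rw [Nat.add_sub_cancel]; ring
  have e1 : (p : ℤ) ^ m - p ^ (m - 1) = p ^ (m - 1) * (p - 1) := by rw [h2]; ring
  simp only [oddWeightTable, List.map_cons, List.map_nil, List.sum_cons, List.sum_nil, sub_self,
    sub_zero, ← sub_sub, ← sub_add, e1, eq_comm (a := w)]
  ring

theorem sum_evenWeightTable (hp : Odd p) (hm : Even m) (hm0 : m ≠ 0) (hml : Nat.gcd m l = 1)
    (hF : Fintype.card F = p ^ m) (w : ℤ) :
    (Nat.card {y : F × F × ZMod p // (hammingNorm (traceEncoder p l F y) : ℤ) = w} : ℚ) =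
      ((evenWeightTable p m).map fun r => r.2 * if w = r.1 then 1 else 0).sum := by
  simp_rw [hammingNorm_traceEncoder hF]
  rw [card_triples_of_even hp hm hm0 hml hF (fun n => (p : ℤ) ^ m - n = w)]
  have h2 : (p : ℤ) ^ m = p ^ (m - 1) * (p - 1) + p ^ (m - 1) := by
    obtain ⟨n, rfl⟩ : ∃ n, m = n + 1 := ⟨m - 1, by omega⟩
    rw [Nat.add_sub_cancel]; ring
  have e1 : (p : ℤ) ^ m - p ^ (m - 1) = p ^ (m - 1) * (p - 1) := by rw [h2]; ring
  simp only [evenWeightTable, List.map_cons, List.map_nil, List.sum_cons, List.sum_nil, sub_self,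
    sub_zero, ← sub_sub, ← sub_add, e1, eq_comm (a := w)]
  ring

end TraceCode

theorem theorem3p2 (p m l : ℕ) [Fact p.Prime] (hp : Odd p) (hm : 3 ≤ m) (hl : 1 ≤ l)
    (hml : Nat.gcd m l = 1)
    (F : Type*) [Field F] [Fintype F] [Algebra (ZMod p) F] (hF : Fintype.card F = p ^ m) :
    codeLength (traceCode p l F) = p ^ m ∧
    Module.finrank (ZMod p) (traceCode p l F) = 2 * m + 1 ∧
    (Odd m → HasWeightDistribution (traceCode p l F) (oddWeightTable p m) ∧
      IsKWeightCode (traceCode p l F) 4) ∧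
    (Even m → HasWeightDistribution (traceCode p l F) (evenWeightTable p m) ∧
      IsKWeightCode (traceCode p l F) 6) := by
  have hm0 : m ≠ 0 := by omega
  have hp1 : (1 : ℚ) < p := by exact_mod_cast (Fact.out : p.Prime).one_lt
  have hpm : (1 : ℚ) < (p : ℚ) ^ m := one_lt_pow₀ hp1 hm0
  have hp0 : (p : ℚ) ≠ 0 := by linarith
  have hq0 : (p : ℚ) - 1 ≠ 0 := by linarith
  have hr0 : (p : ℚ) + 1 ≠ 0 := by linarith
  have hpm0 : (p : ℚ) ^ m - 1 ≠ 0 := by linarith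
  have hinj : Function.Injective (traceEncoder p l F) := by
    -- The row `(0, 1)` of the table, read as a count of triples, says that only the zero triple
    -- encodes the zero word.
    apply injective_of_card_weight_zero
    rcases Nat.even_or_odd m with h | h
    · have h1 := sum_evenWeightTable hp h hm0 hml hF 0
      rw [sum_table_eq (nodup_evenWeightTable hp hm h) (r := (0, 1))
        (by simp [evenWeightTable])] at h1
      exact Nat.cast_eq_one.1 h1
    · have h1 := sum_oddWeightTable hp h hml hF 0
      rw [sum_table_eq (nodup_oddWeightTable p hm) (r := (0, 1))
        (by simp [oddWeightTable])] at h1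
      exact Nat.cast_eq_one.1 h1
  rw [← range_traceEncoder]
  refine ⟨hF, ?_, fun h => ?_, fun h => ?_⟩
  · rw [LinearMap.finrank_range_of_inj hinj, Module.finrank_prod, Module.finrank_prod,
      Module.finrank_self, finrank_of_card_eq hF]
    ring
  · have hd : HasWeightDistribution (LinearMap.range (traceEncoder p l F)) (oddWeightTable p m) :=
      hasWeightDistribution_of_sum (nodup_oddWeightTable p hm) fun w => by
        rw [weightCount_range hinj, sum_oddWeightTable hp h hml hF]
    refine ⟨hd, isKWeightCode_of_hasWeightDistribution hd ?_⟩
    have : (p : ℚ) ^ (m - 1) + 1 ≠ 0 := by positivity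
    simp [hp0, hq0, hpm0, this]
  · have hd : HasWeightDistribution (LinearMap.range (traceEncoder p l F)) (evenWeightTable p m) :=
      hasWeightDistribution_of_sum (nodup_evenWeightTable hp hm h) fun w => by
        rw [weightCount_range hinj, sum_evenWeightTable hp h hm0 hml hF]
    refine ⟨hd, isKWeightCode_of_hasWeightDistribution hd ?_⟩
    have h1 : (p : ℚ) ^ (m - 2) ≤ p ^ (m - 1) := pow_le_pow_right₀ hp1.le (by omega)
    have : (p : ℚ) ^ (m - 1) - p ^ (m - 2) + 1 ≠ 0 := by linarith
    simp [hp0, hq0, hpm0, hr0, this]
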